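/- **Notation.** For a metric space $\mathsf Y$ let $bm\mathsf Y$ and $bc\mathsf Y$ be the bounded Borel measurable and the bounded continuous functions $\mathsf Y\to\mathbb R$, with the supremum norm. Let $\mathsf Z$ be a metric space and $Q$ a Markov transition kernel on $\mathsf Z$. $Q$ is Feller if $z\mapsto\int v(z')Q(z,dz')$ is in $bc\mathsf Z$ for all $v\in bc\mathsf Z$. For $b\in bm\mathsf Z$ let $L_b\colon bm\mathsf Z\to bm\mathsf Z$, $(L_bh)(z)=b(z)\int h(z')Q(z,dz')$, with spectral radius $r(L_b)=\lim_{n\to\infty}\|L_b^n\|^{1/n}$. **The household problem.** Let $\mathsf X=\mathsf A\subset[0,\infty)$ be compact with $0\in\mathsf X$, let $\mathsf S=\mathsf X\times\mathsf Z$, let $R,P,T,\beta\colon\mathsf Z\to\mathbb R$ with $R$ and $P$ bounded below by positive constants and $T\ge0$, $\beta\ge0$, and let $u\colon[0,\infty)\to\mathbb R$. Put $$\Gamma(x,z)=\{a\in\mathsf A: 0\le a\le xR(z)+T(z)R(z)P(z)\},$$ and assume that each $\Gamma(x,z)$ is an interval (this holds if $\mathsf X=[0,M]$, and also if $[0,\,xR(z)+T(z)R(z)P(z)]\subset\mathsf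 X$ for all $(x,z)\in\mathsf S$). Put $$H(x,z,a,v)=u\Big(\frac{x}{P(z)}+T(z)-\frac{a}{R(z)P(z)}\Big)+\beta(z)\int v(a,z')\,Q(z,dz'),$$ for $(x,z)\in\mathsf S$, $a\in\Gamma(x,z)$ and $v\in\mathcal V:=bm\mathsf S$. Let $\Sigma$ be the set of Borel measurable $\sigma\colon\mathsf S\to\mathsf A$ with $\sigma(x,z)\in\Gamma(x,z)$ for all $(x,z)$, and let $(T_\sigma v)(x,z)=H(x,z,\sigma(x,z),v)$ and $(\mathcal Tv)(x,z)=\sup_{a\in\Gamma(x,z)}H(x,z,a,v)$ ($\mathcal T$ is the Bellman operator). Let $v_\sigma(x,z)=\lim_{n}(T_\sigma^nv_0)(x,z)$, which is well defined if the limit exists and is the same for all $v_0\in\mathcal V$; let $v^*=\sup_{\sigma\in\Sigma}v_\sigma$ pointwise; $\sigma\in\Sigma$ is optimal if $v_\sigma=v^*$. **Proposition.** Suppose that (i) $R$, $P$, $T$ and $\beta$ are bounded and continuous, (ii) $u$ is continuous, (iii) $r(L_\beta)<1$, and (iv) $Q$ is Feller. Then: 1. (Regularity) $\mathcal V=bm\mathsf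 S$; $\Gamma$ is continuous (upper and lower hemicontinuous), nonempty valued and compact valued; and on $\operatorname{graph}\Gamma$ the map $(x,z,a)\mapsto H(x,z,a,v)$ is measurable for all $v\in bm\mathsf S$, continuous for all $v\in bc\mathsf S$, and bounded for at least one $v\in bc\mathsf S$. 2. (Monotonicity) If $v,w\in\mathcal V$ and $v\le w$, then $H(x,z,a,v)\le H(x,z,a,w)$ for all $(x,z)\in\mathsf S$ and $a\in\Gamma(x,z)$. 3. (Long-run contractivity) There is a nonnegative $b\in bm\mathsf Z$ with $r(L_b)<1$ such that $$|H(x,z,a,v)-H(x,z,a,w)|\le b(z)\int\sup_{x'\in\mathsf X}|v(x',z')-w(x',z')|\,Q(z,dz')$$ for all $v,w\in\mathcal V$, $(x,z)\in\mathsf S$ and $a\in\Gamma(x,z)$ (read as a lower integral if the integrand is not measurable). 4. (Optimality) (a) For each $\sigma\in\Sigma$, $T_\sigma$ is an eventually contracting self-map of $bm\mathsf S$, and $\mathcal T$ is an eventually contracting self-map of $bc\mathsf S$; that is, some iterate with exponent $n\ge1$ is a contraction in the supremum distance. (b) For each $\sigma\in\Sigma$, $v_\sigma$ is a well-defined element of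 $bm\mathsf S$. (c) $v^*$ is well defined, bounded and continuous, and it is the unique fixed point of $\mathcal T$ in $bc\mathsf S$. (d) An optimal policy exists. (e) A policy $\sigma\in\Sigma$ is optimal if and only if $\sigma(x,z)\in\operatorname{argmax}_{a\in\Gamma(x,z)}H(x,z,a,v^*)$ for each $(x,z)\in\mathsf S$. 5. (Policy iteration) If $(\sigma_k)_{k\ge0}$ in $\Sigma$ satisfies $T_{\sigma_{k}}v_{\sigma_{k-1}}=\mathcal Tv_{\sigma_{k-1}}$ for all $k\ge1$, then $v_{\sigma_k}\to v^*$ uniformly. -/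

import Mathlib

open Set Filter Topology MeasureTheory ProbabilityTheory
open scoped NNReal ENNReal

noncomputable section

/-! ### Function classes -/

/-- `bm Y`: the bounded (Borel) measurable functions `Y → ℝ`. -/
def IsBM {Y : Type*} [MeasurableSpace Y] (f : Y → ℝ) : Prop :=
  Measurable f ∧ ∃ C : ℝ, ∀ y, |f y| ≤ C

/-- `bc Y`: the bounded continuous functions `Y → ℝ`. -/
def IsBC {Y : Type*} [TopologicalSpace Y] (f : Y → ℝ) : Prop :=
  Continuous f ∧ ∃ C : ℝ, ∀ y, |f y| ≤ C

theorem IsBC.isBM {Y : Type*} [TopologicalSpace Y] [MeasurableSpace Y] [OpensMeasurableSpace Y]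
    {f : Y → ℝ} (hf : IsBC f) : IsBM f :=
  ⟨hf.1.measurable, hf.2⟩

/-- The supremum distance `sup_y |f y - g y|`, with values in `[0, ∞]`. -/
def supEDist {Y : Type*} (f g : Y → ℝ) : ℝ≥0∞ := ⨆ y, ENNReal.ofReal |f y - g y|

/-- `M` maps the set `W` of functions into itself and is eventually contracting on it for the
supremum distance: some iterate of `M` is a contraction of `W`. -/
def EventuallyContractingOn {Y : Type*} (M : (Y → ℝ) → (Y → ℝ)) (W : Set (Y → ℝ)) : Prop :=
  MapsTo M W W ∧ ∃ n : ℕ, 1 ≤ n ∧ ∃ c : ℝ≥0, c < 1 ∧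
    ∀ v ∈ W, ∀ w ∈ W, supEDist (M^[n] v) (M^[n] w) ≤ c * supEDist v w

/-- The space `bm Y` with the supremum norm, as a normed space: the measurable functions in the
space of all bounded functions on `Y`. -/
abbrev BMSpace (Y : Type*) [MeasurableSpace Y] : Type _ :=
  ({ carrier := {f | Measurable (f : Y → ℝ)}
     add_mem' := fun {_ _} hf hg => Measurable.add hf hg
     zero_mem' := measurable_const
     smul_mem' := fun c _ hf => Measurable.const_smul hf c } :
    Submodule ℝ (lp (fun _ : Y => ℝ) ∞))

/-- The element of the normed space `BMSpace Y` given by a bounded measurable function. -/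
def IsBM.toBMSpace {Y : Type*} [MeasurableSpace Y] {f : Y → ℝ} (hf : IsBM f) : BMSpace Y :=
  ⟨⟨f, memℓp_infty ⟨hf.2.choose, by rintro _ ⟨y, rfl⟩; exact hf.2.choose_spec y⟩⟩, hf.1⟩

theorem BMSpace.abs_apply_le {Y : Type*} [MeasurableSpace Y] (h : BMSpace Y) (y : Y) :
    |h.1 y| ≤ ‖h‖ :=
  lp.norm_apply_le_norm ENNReal.top_ne_zero h.1 y

theorem BMSpace.isBM {Y : Type*} [MeasurableSpace Y] (h : BMSpace Y) : IsBM (h.1 : Y → ℝ) :=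
  ⟨h.2, ‖h‖, h.abs_apply_le⟩

/-! ### The discount operator and its spectral radius -/

section Discount

variable {Z : Type*} [MeasurableSpace Z]

theorem abs_integral_kernel_le (Q : Kernel Z Z) [IsMarkovKernel Q] {h : Z → ℝ} {C : ℝ}
    (hC : ∀ z, |h z| ≤ C) (z : Z) : |∫ z', h z' ∂(Q z)| ≤ C := by
  have := norm_integral_le_of_norm_le_const (μ := Q z) (f := h) (C := C)
    (Eventually.of_forall hC)
  simpa using this

theorem isBM_discount (Q : Kernel Z Z) [IsMarkovKernel Q] {b h : Z → ℝ} (hb : IsBM b)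
    (hh : IsBM h) : IsBM (fun z => b z * ∫ z', h z' ∂(Q z)) := by
  refine ⟨hb.1.mul hh.1.stronglyMeasurable.integral_kernel.measurable, ?_⟩
  obtain ⟨B, hB⟩ := hb.2
  obtain ⟨C, hC⟩ := hh.2
  refine ⟨B * C, fun z => ?_⟩
  rw [abs_mul]
  exact mul_le_mul (hB z) (abs_integral_kernel_le Q hC z) (abs_nonneg _)
    ((abs_nonneg _).trans (hB z))

theorem BMSpace.integrable (Q : Kernel Z Z) [IsMarkovKernel Q] (h : BMSpace Z) (z : Z) :
    Integrable (h.1 : Z → ℝ) (Q z) :=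
  Integrable.of_bound h.2.aestronglyMeasurable ‖h‖ (Eventually.of_forall h.abs_apply_le)

/-- The bounded linear operator `L_b : bm Z → bm Z`, `(L_b h)(z) = b(z) ∫ h(z') Q(z, dz')`. -/
def discountOp (Q : Kernel Z Z) [IsMarkovKernel Q] (b : Z → ℝ) (hb : IsBM b) :
    BMSpace Z →L[ℝ] BMSpace Z :=
  LinearMap.mkContinuous
    { toFun := fun h => (isBM_discount Q hb h.isBM).toBMSpace
      map_add' := by
        intro h k
        apply Subtype.ext
        apply lp.ext
        funext z
        change b z * ∫ z', (h.1 z' + k.1 z') ∂(Q z)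
          = b z * (∫ z', h.1 z' ∂(Q z)) + b z * ∫ z', k.1 z' ∂(Q z)
        rw [integral_add (h.integrable Q z) (k.integrable Q z), mul_add]
      map_smul' := by
        intro c h
        apply Subtype.ext
        apply lp.ext
        funext z
        change b z * ∫ z', c * h.1 z' ∂(Q z) = c * (b z * ∫ z', h.1 z' ∂(Q z))
        rw [integral_const_mul]
        ring }
    ‖hb.toBMSpace‖ (by
      intro h
      refine lp.norm_le_of_forall_le (by positivity) fun z => ?_
      change |b z * ∫ z', h.1 z' ∂(Q z)| ≤ _
      rw [abs_mul]
      exact mul_le_mul (hb.toBMSpace.abs_apply_le z)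
        (abs_integral_kernel_le Q h.abs_apply_le z) (abs_nonneg _) (norm_nonneg _))

theorem discountOp_apply (Q : Kernel Z Z) [IsMarkovKernel Q] (b : Z → ℝ) (hb : IsBM b)
    (h : BMSpace Z) (z : Z) :
    (discountOp Q b hb h).1 z = b z * ∫ z', h.1 z' ∂(Q z) := rfl

/-- `r` is the spectral radius of `L`, given by Gelfand's formula
`r = lim ‖L ^ n‖ ^ (1 / n)` with the operator norm. -/
def HasSpectralRadius {E : Type*} [NormedAddCommGroup E] [NormedSpace ℝ E] (L : E →L[ℝ] E)
    (r : ℝ) : Prop :=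
  Tendsto (fun n : ℕ => ‖L ^ n‖ ^ (1 / (n : ℝ))) atTop (𝓝 r)

/-- The kernel `Q` has the Feller property: `z ↦ ∫ v(z') Q(z, dz')` is in `bc Z` for all
`v ∈ bc Z`. -/
def IsFeller [TopologicalSpace Z] (Q : Kernel Z Z) : Prop :=
  ∀ v : Z → ℝ, IsBC v → IsBC (fun z => ∫ z', v z' ∂(Q z))

end Discount

/-! ### Dynamic programs -/

/-- A dynamic program `(X, Z, A, Γ, H, V)`: endogenous states `X`, exogenous states `Z` and
actions `A` in metric spaces (`A` separable), a feasible correspondence `Γ`, a continuation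
aggregator `H` and a nonempty set `V` of measurable candidate value functions.
Only the values of `H` at `a ∈ Γ s` and `v ∈ V` are ever used. The instance `BorelSpace (X × Z)`
says that the product sigma-algebra on the state space is the Borel one. -/
structure DynamicProgram (X Z A : Type*)
    [MetricSpace X] [MeasurableSpace X] [BorelSpace X]
    [MetricSpace Z] [MeasurableSpace Z] [BorelSpace Z] [BorelSpace (X × Z)]
    [MetricSpace A] [SecondCountableTopology A] [MeasurableSpace A] [BorelSpace A] where
  /-- the feasible correspondence -/
  Γ : X × Z → Set A
  /-- the continuation aggregator -/
  H : X × Z → A → (X × Z → ℝ) → ℝ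
  /-- the candidate value functions -/
  V : Set (X × Z → ℝ)
  V_nonempty : V.Nonempty
  V_measurable : ∀ v ∈ V, Measurable v

namespace DynamicProgram

variable {X Z A : Type*}
  [MetricSpace X] [MeasurableSpace X] [BorelSpace X]
  [MetricSpace Z] [MeasurableSpace Z] [BorelSpace Z] [BorelSpace (X × Z)]
  [MetricSpace A] [SecondCountableTopology A] [MeasurableSpace A] [BorelSpace A]

/-- Feasible policies: measurable maps `σ` with `σ s ∈ Γ s` for all `s`. -/
def IsPolicy (D : DynamicProgram X Z A) (σ : X × Z → A) : Prop :=
  Measurable σ ∧ ∀ s, σ s ∈ D.Γ s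

/-- The operator `T_σ`. -/
def policyOp (D : DynamicProgram X Z A) (σ : X × Z → A) (v : X × Z → ℝ) : X × Z → ℝ :=
  fun s => D.H s (σ s) v

/-- The Bellman operator `T`. -/
def bellmanOp (D : DynamicProgram X Z A) (v : X × Z → ℝ) : X × Z → ℝ :=
  fun s => sSup ((fun a => D.H s a v) '' D.Γ s)

/-- `w` is the `σ`-value function: `w s = lim (T_σ^n v₀)(s)` for each state `s`, where the limit
exists and is the same for every `v₀ ∈ V`. -/
def IsPolicyValue (D : DynamicProgram X Z A) (σ : X × Z → A) (w : X × Z → ℝ) : Prop :=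
  ∀ v₀ ∈ D.V, ∀ s, Tendsto (fun n : ℕ => ((D.policyOp σ)^[n] v₀) s) atTop (𝓝 (w s))

/-- `vstar` is the value function: every feasible policy has a value function `v_σ`, and
`vstar s` is the (finite) supremum of `v_σ s` over all feasible policies `σ`. -/
def IsValueFunction (D : DynamicProgram X Z A) (vstar : X × Z → ℝ) : Prop :=
  (∀ σ, D.IsPolicy σ → ∃ w, D.IsPolicyValue σ w) ∧
    ∀ s, IsLUB {r : ℝ | ∃ σ w, D.IsPolicy σ ∧ D.IsPolicyValue σ w ∧ w s = r} (vstar s)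

/-- A feasible policy is optimal if it attains the supremum defining the value function, at
every state. -/
def IsOptimal (D : DynamicProgram X Z A) (σ : X × Z → A) : Prop :=
  D.IsPolicy σ ∧ ∃ vstar, D.IsValueFunction vstar ∧ D.IsPolicyValue σ vstar

/-- Regular dynamic programs. -/
structure IsRegular (D : DynamicProgram X Z A) : Prop where
  V_eq : D.V = {v | IsBM v}
  upperHemicontinuous : UpperHemicontinuous D.Γ
  lowerHemicontinuous : LowerHemicontinuous D.Γ
  nonempty : ∀ s, (D.Γ s).Nonempty
  isCompact : ∀ s, IsCompact (D.Γ s)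
  measurable_H : ∀ v, IsBM v →
    Measurable (fun p : {p : (X × Z) × A // p.2 ∈ D.Γ p.1} => D.H p.1.1 p.1.2 v)
  continuous_H : ∀ v, IsBC v →
    Continuous (fun p : {p : (X × Z) × A // p.2 ∈ D.Γ p.1} => D.H p.1.1 p.1.2 v)
  bounded_H : ∃ v, IsBC v ∧ ∃ C : ℝ, ∀ s, ∀ a ∈ D.Γ s, |D.H s a v| ≤ C

/-- Monotonicity. -/
def IsMonotone (D : DynamicProgram X Z A) : Prop :=
  ∀ v ∈ D.V, ∀ w ∈ D.V, (∀ s, v s ≤ w s) → ∀ s, ∀ a ∈ D.Γ s, D.H s a v ≤ D.H s a w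

/-- Long-run contractivity. The integral of the supremum is a `[0, ∞]`-valued integral; for
an integrand that is not measurable, it is the supremum of the integrals of the measurable
functions below it (the lower integral), so it has no junk value. -/
def IsLongRunContractive (D : DynamicProgram X Z A) (Q : Kernel Z Z) [IsMarkovKernel Q] :
    Prop :=
  ∃ (b : Z → ℝ) (hb : IsBM b), (∀ z, 0 ≤ b z) ∧
    (∀ v ∈ D.V, ∀ w ∈ D.V, ∀ x z, ∀ a ∈ D.Γ (x, z),
      ENNReal.ofReal |D.H (x, z) a v - D.H (x, z) a w|
        ≤ ENNReal.ofReal (b z)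
          * ∫⁻ z', (⨆ x', ENNReal.ofReal |v (x', z') - w (x', z')|) ∂(Q z)) ∧
    ∃ r < 1, HasSpectralRadius (discountOp Q b hb) r

/-- The optimality results: eventual contractivity, existence of policy values, the value
function as the unique solution of Bellman's equation in `bc S`, existence of an optimal policy,
and Bellman's principle of optimality. -/
structure OptimalityResults (D : DynamicProgram X Z A) : Prop where
  policyOp_contracting : ∀ σ, D.IsPolicy σ →
    EventuallyContractingOn (D.policyOp σ) {v | IsBM v}
  bellmanOp_contracting : EventuallyContractingOn D.bellmanOp {v | IsBC v}
  policyValue : ∀ σ, D.IsPolicy σ → ∃ w, IsBM w ∧ D.IsPolicyValue σ w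
  valueFunction : ∃ vstar, D.IsValueFunction vstar ∧ IsBC vstar ∧ D.bellmanOp vstar = vstar ∧
    ∀ v, IsBC v → D.bellmanOp v = v → v = vstar
  exists_optimal : ∃ σ, D.IsOptimal σ
  optimal_iff : ∀ vstar, D.IsValueFunction vstar → ∀ σ, D.IsPolicy σ →
    (D.IsOptimal σ ↔ ∀ s, σ s ∈ D.Γ s ∧ IsMaxOn (fun a => D.H s a vstar) (D.Γ s) (σ s))

/-- Convergence of Howard's policy iteration: if feasible policies `σ k` with values `v k`
satisfy `T_{σ (k + 1)} (v k) = T (v k)` for all `k`, then `v k` converges uniformly to the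
value function. -/
def PolicyIterationConverges (D : DynamicProgram X Z A) : Prop :=
  ∀ (σ : ℕ → X × Z → A) (v : ℕ → X × Z → ℝ),
    (∀ k, D.IsPolicy (σ k)) → (∀ k, D.IsPolicyValue (σ k) (v k)) →
    (∀ k, D.policyOp (σ (k + 1)) (v k) = D.bellmanOp (v k)) →
    ∀ vstar, D.IsValueFunction vstar → TendstoUniformly v vstar atTop

end DynamicProgram

/-! ### The household problem with taxation -/

/-- The household problem: `X = A` is a set of asset levels, consumption is
`F(x, z, a) = x / P(z) + T(z) - a / (R(z) P(z))`, the feasible set is the part of the action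
space `A` in `[0, x R(z) + T(z) R(z) P(z)]`, the aggregator is
`H(x, z, a, v) = u(F(x, z, a)) + β(z) ∫ v(a, z') Q(z, dz')`, and `V = bm S`. -/
def householdProblem {Z : Type*} [MetricSpace Z] [MeasurableSpace Z] [BorelSpace Z]
    (X : Set ℝ) (R P T β : Z → ℝ) (u : ℝ → ℝ) (Q : Kernel Z Z) : DynamicProgram X Z X where
  Γ s := {a | (a : ℝ) ∈ Icc 0 ((s.1 : ℝ) * R s.2 + T s.2 * R s.2 * P s.2)}
  H s a v := u ((s.1 : ℝ) / P s.2 + T s.2 - (a : ℝ) / (R s.2 * P s.2))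
    + β s.2 * ∫ z', v (a, z') ∂(Q s.2)
  V := {v | IsBM v}
  V_nonempty := ⟨fun _ => 0, measurable_const, 0, by simp⟩
  V_measurable := fun _ hv => hv.1

end

/-! ### Fixed points of maps with summable Lipschitz constants of iterates -/

/-! The action is the next asset level, so if |v - w| ≤ h(z) for every x, then exchanging v for w
moves the aggregator at (x, z, a) by at most β(z) ∫ h dQ(z, ·). Hence each T_σ, and the Bellman
operator as a supremum, is dominated by the linear operator L = L_β on functions of z alone
(`IsDominated`). Iterating, T^n v and T^n w differ by at most ‖L^n‖ sup|v - w|, and r(L) < 1 makes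
‖L^n‖ summable even where β exceeds 1. So T_σ on bm and the Bellman operator on bc have globally
attracting fixed points (`exists_fixedPoint_of_summable`).

That the Bellman operator preserves bc is Berge's theorem. It needs both hemicontinuities of Γ and
joint continuity of the expected continuation value, which an oscillation argument extracts from the
Feller property (`IsFeller.continuous_integral_section`).

The greatest maximizer is a measurable greedy policy, and its value is the Bellman fixed point v.
Any policy τ satisfies T_τ v ≤ v, so by monotonicity its value is at most v
(`isValueFunction_of_fixedPoint`). Policy iterates are squeezed between value iterates and v. -/

theorem abs_sub_le_supEDist {Y : Type*} {f g : Y → ℝ} (h : supEDist f g ≠ ∞) (y : Y) :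
    |f y - g y| ≤ (supEDist f g).toReal :=
  (ENNReal.ofReal_le_iff_le_toReal h).1 (le_iSup (fun y => ENNReal.ofReal |f y - g y|) y)

theorem supEDist_ne_top {Y : Type*} {f g : Y → ℝ} {C D : ℝ} (hf : ∀ y, |f y| ≤ C)
    (hg : ∀ y, |g y| ≤ D) : supEDist f g ≠ ∞ := by
  refine ne_top_of_le_ne_top (ENNReal.ofReal_ne_top (r := C + D)) (iSup_le fun y => ?_)
  exact ENNReal.ofReal_le_ofReal ((abs_sub _ _).trans (add_le_add (hf y) (hg y)))

theorem tendstoUniformly_of_abs_sub_le {Y : Type*} {F : ℕ → Y → ℝ} {f : Y → ℝ} {e : ℕ → ℝ}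
    (he : Tendsto e atTop (𝓝 0)) (h : ∀ n y, |F n y - f y| ≤ e n) :
    TendstoUniformly F f atTop := by
  rw [Metric.tendstoUniformly_iff]
  intro ε hε
  filter_upwards [he.eventually (gt_mem_nhds hε)] with n hn y
  rw [dist_comm, Real.dist_eq]
  exact (h n y).trans_lt hn

theorem IsBM.of_tendstoUniformly {Y : Type*} [MeasurableSpace Y] {F : ℕ → Y → ℝ} {f : Y → ℝ}
    (hF : ∀ n, IsBM (F n)) (h : TendstoUniformly F f atTop) : IsBM f := by
  refine ⟨measurable_of_tendsto_metrizable (fun n => (hF n).1)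
    (tendsto_pi_nhds.2 fun y => h.tendsto_at y), ?_⟩
  obtain ⟨n, hn⟩ := (Metric.tendstoUniformly_iff.1 h 1 one_pos).exists
  obtain ⟨C, hC⟩ := (hF n).2
  refine ⟨C + 1, fun y => ?_⟩
  have h1 := hn y
  rw [Real.dist_eq] at h1
  have h2 := abs_sub_abs_le_abs_sub (f y) (F n y)
  linarith [hC y]

theorem IsBC.of_tendstoUniformly {Y : Type*} [TopologicalSpace Y] {F : ℕ → Y → ℝ} {f : Y → ℝ}
    (hF : ∀ n, IsBC (F n)) (h : TendstoUniformly F f atTop) : IsBC f := by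
  borelize Y
  exact ⟨h.continuous (Frequently.of_forall fun n => (hF n).1),
    (IsBM.of_tendstoUniformly (fun n => (hF n).isBM) h).2⟩

section FixedPoint

variable {Y : Type*} {M : (Y → ℝ) → (Y → ℝ)} {W : Set (Y → ℝ)} {c : ℕ → ℝ}

/-- No single step need contract: the orbit of v telescopes into increments bounded by c n * d, so
it converges uniformly by the Weierstrass test. The Lipschitz bound at n = 1 makes the limit a fixed
point, and c n → 0 makes it attract all of W. -/
theorem exists_fixedPoint_of_summable (hMW : MapsTo M W W) (hne : W.Nonempty)
    (hbdd : ∀ v ∈ W, ∃ C, ∀ y, |v y| ≤ C)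
    (hlim : ∀ (F : ℕ → Y → ℝ) (f : Y → ℝ), (∀ n, F n ∈ W) → TendstoUniformly F f atTop → f ∈ W)
    (hc : Summable c)
    (hM : ∀ n, ∀ v ∈ W, ∀ w ∈ W, ∀ d, (∀ y, |v y - w y| ≤ d) →
      ∀ y, |M^[n] v y - M^[n] w y| ≤ c n * d) :
    ∃ w ∈ W, M w = w ∧ ∀ v ∈ W, TendstoUniformly (fun n => M^[n] v) w atTop := by
  have hdist : ∀ v ∈ W, ∀ w ∈ W, ∃ d, ∀ y, |v y - w y| ≤ d := by
    intro v hv w hw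
    obtain ⟨C, hC⟩ := hbdd v hv
    obtain ⟨D, hD⟩ := hbdd w hw
    exact ⟨C + D, fun y => (abs_sub _ _).trans (add_le_add (hC y) (hD y))⟩
  obtain ⟨v, hv⟩ := hne
  have hiter : ∀ n, M^[n] v ∈ W := fun n => hMW.iterate n hv
  obtain ⟨d, hd⟩ := hdist (M v) (hMW hv) v hv
  have hU := tendstoUniformly_tsum_nat (f := fun n y => M^[n] (M v) y - M^[n] v y)
    (hc.mul_right d) (fun n y => hM n _ (hMW hv) _ hv d hd y)
  set w : Y → ℝ := fun y => v y + ∑' n, (M^[n] (M v) y - M^[n] v y) with hw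
  have hvw : TendstoUniformly (fun n => M^[n] v) w atTop := by
    rw [Metric.tendstoUniformly_iff] at hU ⊢
    intro ε hε
    filter_upwards [hU ε hε] with n hn y
    have h1 := hn y
    simp only [← Function.iterate_succ_apply] at h1
    rw [Finset.sum_range_sub (fun n => M^[n] v y)] at h1
    rw [Real.dist_eq] at h1 ⊢
    simp only [hw, ← Function.iterate_succ_apply]
    convert h1 using 2
    simp only [Function.iterate_zero, id]
    ring
  have hwW : w ∈ W := hlim _ _ hiter hvw
  have hfix : M w = w := by
    funext y
    have h1 : Tendsto (fun n => M^[n + 1] v y) atTop (𝓝 (w y)) :=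
      (hvw.tendsto_at y).comp (tendsto_add_atTop_nat 1)
    refine tendsto_nhds_unique ?_ h1
    rw [Metric.tendsto_atTop]
    intro ε hε
    -- `c 1` is a Lipschitz constant of M; the extra 1 keeps the denominator positive.
    have hδ : 0 < ε / (|c 1| + 1) := by positivity
    obtain ⟨N, hN⟩ := eventually_atTop.1 (Metric.tendstoUniformly_iff.1 hvw _ hδ)
    refine ⟨N, fun n hn => ?_⟩
    have h2 := hM 1 _ (hiter n) w hwW (ε / (|c 1| + 1)) (fun y => by
      have := hN n hn y
      rw [dist_comm, Real.dist_eq] at this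
      exact this.le) y
    simp only [Function.iterate_one] at h2
    rw [Function.iterate_succ_apply', Real.dist_eq]
    refine h2.trans_lt ?_
    rw [← mul_div_assoc, div_lt_iff₀ (by positivity)]
    nlinarith [le_abs_self (c 1)]
  refine ⟨w, hwW, hfix, fun v' hv' => ?_⟩
  obtain ⟨e, he⟩ := hdist v' hv' w hwW
  refine tendstoUniformly_of_abs_sub_le (e := fun n => c n * e)
    (by simpa using hc.tendsto_atTop_zero.mul_const e) fun n y => ?_
  have h := hM n v' hv' w hwW e he y
  rwa [Function.iterate_fixed hfix] at h

theorem eventuallyContractingOn_of_summable (hMW : MapsTo M W W)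
    (hbdd : ∀ v ∈ W, ∃ C, ∀ y, |v y| ≤ C) (hc : Summable c) (hc0 : ∀ n, 0 ≤ c n)
    (hM : ∀ n, ∀ v ∈ W, ∀ w ∈ W, ∀ d, (∀ y, |v y - w y| ≤ d) →
      ∀ y, |M^[n] v y - M^[n] w y| ≤ c n * d) :
    EventuallyContractingOn M W := by
  refine ⟨hMW, ?_⟩
  obtain ⟨n, hn, hn1⟩ := ((hc.tendsto_atTop_zero.eventually (gt_mem_nhds one_pos)).and
    (eventually_ge_atTop 1)).exists
  refine ⟨n, hn1, ⟨c n, hc0 n⟩, by exact_mod_cast hn, fun v hv w hw => iSup_le fun y => ?_⟩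
  obtain ⟨C, hC⟩ := hbdd v hv
  obtain ⟨D, hD⟩ := hbdd w hw
  have htop := supEDist_ne_top hC hD
  refine (ENNReal.ofReal_le_ofReal
    (hM n v hv w hw _ (abs_sub_le_supEDist htop) y)).trans ?_
  rw [ENNReal.ofReal_mul (hc0 n), ENNReal.ofReal_toReal htop,
    ENNReal.ofReal_eq_coe_nnreal (hc0 n)]
  exact le_rfl

end FixedPoint

set_option synthInstance.maxHeartbeats 200000
/-! ### Iterates dominated by a discount operator -/

/-- Root test: for ρ strictly between r and 1, eventually ‖L^n‖ ≤ ρ^n. -/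
theorem HasSpectralRadius.summable_norm_pow {E : Type*} [NormedAddCommGroup E] [NormedSpace ℝ E]
    {L : E →L[ℝ] E} {r : ℝ} (h : HasSpectralRadius L r) (hr : r < 1) :
    Summable fun n : ℕ => ‖L ^ n‖ := by
  have hr0 : 0 ≤ r := ge_of_tendsto' h fun n => by positivity
  obtain ⟨ρ, hrρ, hρ1⟩ := exists_between hr
  have hρ0 : 0 ≤ ρ := hr0.trans hrρ.le
  refine Summable.of_norm_bounded_eventually_nat (summable_geometric_of_lt_one hρ0 hρ1) ?_
  -- At n = 0 the exponent 1 / n is 0 by convention, so that term carries no information and is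
  -- dropped.
  filter_upwards [h.eventually (gt_mem_nhds hrρ), eventually_ge_atTop 1] with n hn hn1
  have hn0 : n ≠ 0 := by omega
  rw [norm_norm]
  calc ‖L ^ n‖ = (‖L ^ n‖ ^ (1 / (n : ℝ))) ^ n := by
        rw [one_div, Real.rpow_inv_natCast_pow (norm_nonneg _) hn0]
    _ ≤ ρ ^ n := by gcongr

/-- The constant function `d` as an element of `BMSpace Y`. -/
noncomputable def BMSpace.const (Y : Type*) [MeasurableSpace Y] (d : ℝ) : BMSpace Y :=
  IsBM.toBMSpace (f := fun _ : Y => d) ⟨measurable_const, |d|, fun _ => le_rfl⟩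

/-- Only an inequality, because Y may be empty. -/
theorem BMSpace.norm_const_le (Y : Type*) [MeasurableSpace Y] (d : ℝ) :
    ‖BMSpace.const Y d‖ ≤ |d| :=
  lp.norm_le_of_forall_le (abs_nonneg d) fun _ => le_rfl

/-- The bound is carried through the induction as a function of z, and the norm is taken only at the
end; this yields ‖L^n‖ rather than ‖L‖^n, which need not decay. Working with arbitrary measurable
majorants h avoids the supremum over x, which need not be measurable. -/
theorem abs_iterate_sub_le {X Z : Type*} [MeasurableSpace Z]
    {L : BMSpace Z →L[ℝ] BMSpace Z} {M : (X × Z → ℝ) → (X × Z → ℝ)} {W : Set (X × Z → ℝ)}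
    (hMW : MapsTo M W W)
    (hM : ∀ v ∈ W, ∀ w ∈ W, ∀ h : BMSpace Z, (∀ x z, |v (x, z) - w (x, z)| ≤ h.1 z) →
      ∀ x z, |M v (x, z) - M w (x, z)| ≤ (L h).1 z)
    (n : ℕ) {v w : X × Z → ℝ} (hv : v ∈ W) (hw : w ∈ W) {d : ℝ} (hd : ∀ s, |v s - w s| ≤ d)
    (s : X × Z) : |M^[n] v s - M^[n] w s| ≤ ‖L ^ n‖ * d := by
  have key : ∀ n : ℕ, ∀ x z, |M^[n] v (x, z) - M^[n] w (x, z)|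
      ≤ ((L ^ n) (BMSpace.const Z d)).1 z := by
    intro n
    induction n with
    | zero => exact fun x z => hd (x, z)
    | succ n ih =>
      intro x z
      rw [Function.iterate_succ_apply', Function.iterate_succ_apply', pow_succ']
      exact hM _ (hMW.iterate n hv) _ (hMW.iterate n hw) _ ih x z
  calc |M^[n] v s - M^[n] w s| ≤ ((L ^ n) (BMSpace.const Z d)).1 s.2 := key n s.1 s.2
    _ ≤ ‖(L ^ n) (BMSpace.const Z d)‖ := (le_abs_self _).trans (BMSpace.abs_apply_le _ _)
    _ ≤ ‖L ^ n‖ * ‖BMSpace.const Z d‖ := (L ^ n).le_opNorm _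
    _ ≤ ‖L ^ n‖ * d := by
        gcongr
        exact (BMSpace.norm_const_le Z d).trans_eq (abs_of_nonneg ((abs_nonneg _).trans (hd s)))

/-! ### The maximum theorem on a compact action space -/

section Maximum

variable {S A : Type*} [TopologicalSpace S] [TopologicalSpace A] {Γ : S → Set A}

theorem UpperHemicontinuous.isClosed_graph [RegularSpace A] (hΓ : UpperHemicontinuous Γ)
    (hcl : ∀ s, IsClosed (Γ s)) : IsClosed {p : S × A | p.2 ∈ Γ p.1} := by
  refine isClosed_of_closure_subset fun p hp => ?_
  have : NeBot (𝓝[{p : S × A | p.2 ∈ Γ p.1}] p) := mem_closure_iff_nhdsWithin_neBot.1 hp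
  exact (upperHemicontinuous_iff.1 hΓ p.1).mem_of_tendsto (hcl p.1)
    (l := 𝓝[{p : S × A | p.2 ∈ Γ p.1}] p) (x := Prod.fst) (y := Prod.snd)
    ((continuous_fst.tendsto p).mono_left inf_le_left)
    (Eventually.frequently (eventually_mem_nhdsWithin))
    ((continuous_snd.tendsto p).mono_left inf_le_left)

theorem isClosed_image_fst_graph [CompactSpace A] (hG : IsClosed {p : S × A | p.2 ∈ Γ p.1})
    {C : Set {p : S × A // p.2 ∈ Γ p.1}} (hC : IsClosed C) :
    IsClosed ((fun p : {p : S × A // p.2 ∈ Γ p.1} => p.1.1) '' C) := by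
  have h := isClosedMap_fst_of_compactSpace _ (hG.isClosedEmbedding_subtypeVal.isClosedMap C hC)
  rwa [image_image] at h

variable {f : S → A → ℝ}

theorem continuousOn_of_continuous_graph
    (hf : Continuous fun p : {p : S × A // p.2 ∈ Γ p.1} => f p.1.1 p.1.2) (s : S) :
    ContinuousOn (f s) (Γ s) := by
  rw [continuousOn_iff_continuous_domRestrict]
  exact hf.comp (Continuous.subtype_mk (continuous_const.prodMk continuous_subtype_val)
    fun a : Γ s => a.2 : Continuous fun a : Γ s =>
      (⟨(s, a.1), a.2⟩ : {p : S × A // p.2 ∈ Γ p.1}))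

/-- Berge's maximum theorem, value part. -/
theorem continuous_sSup_image_correspondence [CompactSpace A] [T3Space A]
    (hu : UpperHemicontinuous Γ) (hl : LowerHemicontinuous Γ) (hne : ∀ s, (Γ s).Nonempty)
    (hcpt : ∀ s, IsCompact (Γ s))
    (hf : Continuous fun p : {p : S × A // p.2 ∈ Γ p.1} => f p.1.1 p.1.2) :
    Continuous fun s => sSup (f s '' Γ s) := by
  have hmax := fun s => (hcpt s).exists_sSup_image_eq_and_ge (hne s)
    (continuousOn_of_continuous_graph hf s)
  rw [continuous_iff_lower_upperSemicontinuous, lowerSemicontinuous_iff_isOpen_preimage,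
    upperSemicontinuous_iff_isClosed_preimage]
  constructor
  · intro c
    rw [isOpen_iff_mem_nhds]
    intro s hs
    obtain ⟨a, ha, hsa, -⟩ := hmax s
    have hs' : c < f s a := by rw [← hsa]; exact hs
    have hnhds := (hf.tendsto (⟨(s, a), ha⟩ : {p : S × A // p.2 ∈ Γ p.1})).eventually
      (lt_mem_nhds hs')
    rw [nhds_subtype_eq_comap, eventually_comap, nhds_prod_eq] at hnhds
    obtain ⟨U, hU, V, hV, hUV⟩ := mem_prod_iff.1 hnhds
    -- Nearby states have feasible actions close to the maximizer a, so their suprema also exceed c.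
    have hev := lowerHemicontinuousAt_iff.1 (lowerHemicontinuous_iff.1 hl s) (interior V)
      isOpen_interior ⟨a, ha, mem_interior_iff_mem_nhds.2 hV⟩
    filter_upwards [hU, hev] with s' hs'U ⟨a', ha', haV⟩
    have h1 : c < f s' a' :=
      hUV (mk_mem_prod hs'U (interior_subset haV)) ⟨(s', a'), ha'⟩ rfl
    obtain ⟨a'', -, h2, h3⟩ := hmax s'
    show c < sSup (f s' '' Γ s')
    rw [h2]
    exact h1.trans_le (h3 a' ha')
  · intro c
    -- Since the maximum is attained, {c ≤ max} is the projection of a closed part of the graph, and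
    -- projection along a compact factor is a closed map.
    convert isClosed_image_fst_graph (hu.isClosed_graph fun s => (hcpt s).isClosed)
      (isClosed_le continuous_const hf : IsClosed {p | c ≤ f p.1.1 p.1.2}) using 1
    ext s
    obtain ⟨a, ha, hsa, hge⟩ := hmax s
    simp only [mem_preimage, mem_Ici, hsa, mem_image]
    constructor
    · exact fun h => ⟨⟨(s, a), ha⟩, h, rfl⟩
    · rintro ⟨⟨⟨s', a'⟩, ha'⟩, h, rfl⟩
      exact le_trans h (hge a' ha')

/-- For a compact set of real actions, the greatest maximizer is a measurable selection. -/
theorem exists_measurable_isMaxOn [MeasurableSpace S] [OpensMeasurableSpace S] {K : Set ℝ}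
    [CompactSpace K] {Γ : S → Set K} {f : S → K → ℝ}
    (hu : UpperHemicontinuous Γ) (hl : LowerHemicontinuous Γ) (hne : ∀ s, (Γ s).Nonempty)
    (hcpt : ∀ s, IsCompact (Γ s))
    (hf : Continuous fun p : {p : S × K // p.2 ∈ Γ p.1} => f p.1.1 p.1.2) :
    ∃ σ : S → K, Measurable σ ∧ ∀ s, σ s ∈ Γ s ∧ IsMaxOn (f s) (Γ s) (σ s) := by
  have hm := continuous_sSup_image_correspondence hu hl hne hcpt hf
  have hmax := fun s => (hcpt s).exists_sSup_image_eq_and_ge (hne s)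
    (continuousOn_of_continuous_graph hf s)
  set C : Set {p : S × K // p.2 ∈ Γ p.1} := {p | sSup (f p.1.1 '' Γ p.1.1) ≤ f p.1.1 p.1.2}
    with hC
  have hCc : IsClosed C := isClosed_le
    (hm.comp (continuous_fst.comp continuous_subtype_val)) hf
  have hG := hu.isClosed_graph fun s => (hcpt s).isClosed
  have hgr : ∀ s, ∃ a : K, IsGreatest {a | a ∈ Γ s ∧ sSup (f s '' Γ s) ≤ f s a} a := by
    intro s
    refine IsCompact.exists_isGreatest ?_ ?_
    · exact ((continuousOn_of_continuous_graph hf s).preimage_isClosed_of_isClosed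
        (hcpt s).isClosed isClosed_Ici).isCompact
    · obtain ⟨a, ha, hsa, -⟩ := hmax s
      exact ⟨a, ha, hsa.le⟩
  choose σ hσ using hgr
  refine ⟨σ, ?_, fun s => ⟨(hσ s).1.1, fun a ha => ?_⟩⟩
  · refine Measurable.subtype_mk (f := fun s => (σ s : ℝ)) (measurable_of_Ici fun c => ?_)
      (h := fun s => (σ s).2)
    -- σ s ≥ c exactly when some maximizer is ≥ c, so this set is again a projection of a closed
    -- set: σ is upper semicontinuous.
    refine IsClosed.measurableSet ?_
    have hD : IsClosed {p : {p : S × K // p.2 ∈ Γ p.1} | c ≤ (p.1.2 : ℝ)} :=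
      isClosed_le continuous_const (by fun_prop)
    convert isClosed_image_fst_graph hG (hCc.inter hD) using 1
    ext s
    simp only [mem_preimage, mem_Ici, mem_image]
    constructor
    · exact fun h => ⟨⟨(s, σ s), (hσ s).1.1⟩, ⟨(hσ s).1.2, h⟩, rfl⟩
    · rintro ⟨⟨⟨s', a'⟩, ha'⟩, ⟨h1, h2⟩, rfl⟩
      exact le_trans h2 ((hσ s').2 ⟨ha', h1⟩)
  · obtain ⟨a', -, hsa, hge⟩ := hmax s
    exact (hge a ha).trans (hsa ▸ (hσ s).1.2)

end Maximum

/-! ### Regular, monotone and discounted dynamic programs -/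

namespace DynamicProgram

variable {X Z A : Type*}
  [MetricSpace X] [MeasurableSpace X] [BorelSpace X]
  [MetricSpace Z] [MeasurableSpace Z] [BorelSpace Z] [BorelSpace (X × Z)]
  [MetricSpace A] [SecondCountableTopology A] [MeasurableSpace A] [BorelSpace A]
  {D : DynamicProgram X Z A} {L : BMSpace Z →L[ℝ] BMSpace Z}

/-- Differences of aggregator values are dominated by the operator `L`, applied to any bounded
measurable bound (uniform in the endogenous state) for the difference of the continuation
values. -/
def IsDominated (D : DynamicProgram X Z A) (L : BMSpace Z →L[ℝ] BMSpace Z) : Prop :=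
  ∀ v w, IsBM v → IsBM w → ∀ h : BMSpace Z, (∀ x z, |v (x, z) - w (x, z)| ≤ h.1 z) →
    ∀ x z, ∀ a ∈ D.Γ (x, z), |D.H (x, z) a v - D.H (x, z) a w| ≤ (L h).1 z

/-- The majorant k lies above the supremum over x' pointwise, and the lower integral is monotone, so
measurability of that supremum never enters. -/
theorem isDominated_of_lintegral {Q : Kernel Z Z} [IsMarkovKernel Q] {b : Z → ℝ} (hb : IsBM b)
    (hb0 : ∀ z, 0 ≤ b z) (hV : D.V = {v | IsBM v})
    (h : ∀ v ∈ D.V, ∀ w ∈ D.V, ∀ x z, ∀ a ∈ D.Γ (x, z),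
      ENNReal.ofReal |D.H (x, z) a v - D.H (x, z) a w|
        ≤ ENNReal.ofReal (b z)
          * ∫⁻ z', (⨆ x', ENNReal.ofReal |v (x', z') - w (x', z')|) ∂(Q z)) :
    D.IsDominated (discountOp Q b hb) := by
  intro v w hv hw k hk x z a ha
  have hk0 : ∀ z, 0 ≤ k.1 z := fun z => (abs_nonneg _).trans (hk x z)
  rw [discountOp_apply, ← ENNReal.ofReal_le_ofReal_iff
    (mul_nonneg (hb0 z) (integral_nonneg hk0)), ENNReal.ofReal_mul (hb0 z),
    ofReal_integral_eq_lintegral_ofReal (k.integrable Q z) (Eventually.of_forall hk0)]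
  refine (h v (hV ▸ hv) w (hV ▸ hw) x z a ha).trans ?_
  gcongr with z'
  exact iSup_le fun x' => ENNReal.ofReal_le_ofReal (hk x' z')

/-! ### Consequences of domination for the policy and Bellman operators -/

namespace IsDominated

theorem policyOp (hD : D.IsDominated L) {σ : X × Z → A} (hσ : D.IsPolicy σ) {v w : X × Z → ℝ}
    (hv : IsBM v) (hw : IsBM w) {h : BMSpace Z} (hvw : ∀ x z, |v (x, z) - w (x, z)| ≤ h.1 z)
    (x : X) (z : Z) : |D.policyOp σ v (x, z) - D.policyOp σ w (x, z)| ≤ (L h).1 z :=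
  hD v w hv hw h hvw x z _ (hσ.2 _)

/-- Regularity bounds the aggregator for one function only; domination with a constant majorant
transfers the bound to every other one. -/
theorem exists_bound (hD : D.IsDominated L) (hreg : D.IsRegular) {v : X × Z → ℝ} (hv : IsBM v) :
    ∃ C, ∀ s, ∀ a ∈ D.Γ s, |D.H s a v| ≤ C := by
  obtain ⟨w, hw, C, hC⟩ := hreg.bounded_H
  obtain ⟨B, hB⟩ := hv.2
  obtain ⟨B', hB'⟩ := hw.2
  refine ⟨‖L (BMSpace.const Z (B + B'))‖ + C, fun s a ha => ?_⟩
  have h1 := hD v w hv hw.isBM (BMSpace.const Z (B + B'))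
    (fun x z => (abs_sub _ _).trans (add_le_add (hB _) (hB' _))) s.1 s.2 a ha
  have h2 := (le_abs_self _).trans ((L (BMSpace.const Z (B + B'))).abs_apply_le s.2)
  have h3 := abs_sub_abs_le_abs_sub (D.H s a v) (D.H s a w)
  change |D.H s a v - D.H s a w| ≤ _ at h1
  linarith [hC s a ha]

theorem bddAbove_image (hD : D.IsDominated L) (hreg : D.IsRegular) {v : X × Z → ℝ}
    (hv : IsBM v) (s : X × Z) : BddAbove ((fun a => D.H s a v) '' D.Γ s) := by
  obtain ⟨C, hC⟩ := hD.exists_bound hreg hv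
  exact ⟨C, by rintro _ ⟨a, ha, rfl⟩; exact (le_abs_self _).trans (hC s a ha)⟩

theorem le_bellmanOp (hD : D.IsDominated L) (hreg : D.IsRegular) {v : X × Z → ℝ}
    (hv : IsBM v) {s : X × Z} {a : A} (ha : a ∈ D.Γ s) : D.H s a v ≤ D.bellmanOp v s :=
  le_csSup (hD.bddAbove_image hreg hv s) ⟨a, ha, rfl⟩

theorem bellmanOp_mono (hD : D.IsDominated L) (hreg : D.IsRegular) (hmono : D.IsMonotone)
    {v w : X × Z → ℝ} (hv : IsBM v) (hw : IsBM w) (hvw : ∀ s, v s ≤ w s) (s : X × Z) :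
    D.bellmanOp v s ≤ D.bellmanOp w s := by
  refine csSup_le ((hreg.nonempty s).image _) ?_
  rintro _ ⟨a, ha, rfl⟩
  exact (hmono v (hreg.V_eq ▸ hv) w (hreg.V_eq ▸ hw) hvw s a ha).trans
    (hD.le_bellmanOp hreg hw ha)

theorem bellmanOp (hD : D.IsDominated L) (hreg : D.IsRegular) {v w : X × Z → ℝ}
    (hv : IsBM v) (hw : IsBM w) {h : BMSpace Z} (hvw : ∀ x z, |v (x, z) - w (x, z)| ≤ h.1 z)
    (x : X) (z : Z) : |D.bellmanOp v (x, z) - D.bellmanOp w (x, z)| ≤ (L h).1 z := by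
  have key : ∀ v w : X × Z → ℝ, IsBM v → IsBM w → (∀ x z, |v (x, z) - w (x, z)| ≤ h.1 z) →
      D.bellmanOp v (x, z) ≤ (L h).1 z + D.bellmanOp w (x, z) := by
    intro v w hv hw hvw
    refine csSup_le ((hreg.nonempty _).image _) ?_
    rintro _ ⟨a, ha, rfl⟩
    have h1 := (abs_le.1 (hD v w hv hw h hvw x z a ha)).2
    have h2 := hD.le_bellmanOp hreg hw ha
    dsimp only
    linarith
  have h1 := key v w hv hw hvw
  have h2 := key w v hw hv fun x z => by rw [abs_sub_comm]; exact hvw x z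
  exact abs_le.2 ⟨by linarith, by linarith⟩

theorem isBM_policyOp (hD : D.IsDominated L) (hreg : D.IsRegular) {σ : X × Z → A}
    (hσ : D.IsPolicy σ) {v : X × Z → ℝ} (hv : IsBM v) : IsBM (D.policyOp σ v) := by
  obtain ⟨C, hC⟩ := hD.exists_bound hreg hv
  refine ⟨?_, C, fun s => hC s _ (hσ.2 s)⟩
  exact (hreg.measurable_H v hv).comp
    (Measurable.subtype_mk (measurable_id.prodMk hσ.1) (h := hσ.2))

theorem isBC_bellmanOp [CompactSpace A] (hD : D.IsDominated L) (hreg : D.IsRegular)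
    {v : X × Z → ℝ} (hv : IsBC v) : IsBC (D.bellmanOp v) := by
  refine ⟨continuous_sSup_image_correspondence hreg.upperHemicontinuous
    hreg.lowerHemicontinuous hreg.nonempty hreg.isCompact (hreg.continuous_H v hv), ?_⟩
  obtain ⟨C, hC⟩ := hD.exists_bound hreg hv.isBM
  refine ⟨C, fun s => abs_le.2 ⟨?_, csSup_le ((hreg.nonempty s).image _) ?_⟩⟩
  · obtain ⟨a, ha⟩ := hreg.nonempty s
    exact (abs_le.1 (hC s a ha)).1.trans (hD.le_bellmanOp hreg hv.isBM ha)
  · rintro _ ⟨a, ha, rfl⟩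
    exact (abs_le.1 (hC s a ha)).2

theorem abs_policyOp_iterate_sub_le (hD : D.IsDominated L) (hreg : D.IsRegular)
    {σ : X × Z → A} (hσ : D.IsPolicy σ) (n : ℕ) :
    ∀ v ∈ {v | IsBM v}, ∀ w ∈ {v | IsBM v}, ∀ d, (∀ y, |v y - w y| ≤ d) →
      ∀ y, |(D.policyOp σ)^[n] v y - (D.policyOp σ)^[n] w y| ≤ ‖L ^ n‖ * d :=
  fun _ hv _ hw _ hd y => abs_iterate_sub_le (M := D.policyOp σ) (W := {v | IsBM v}) (fun _ hv => hD.isBM_policyOp hreg hσ hv)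
    (fun _ hv _ hw _ hvw => hD.policyOp hσ hv hw hvw) n hv hw hd y

theorem abs_bellmanOp_iterate_sub_le [CompactSpace A] (hD : D.IsDominated L)
    (hreg : D.IsRegular) (n : ℕ) :
    ∀ v ∈ {v | IsBC v}, ∀ w ∈ {v | IsBC v}, ∀ d, (∀ y, |v y - w y| ≤ d) →
      ∀ y, |D.bellmanOp^[n] v y - D.bellmanOp^[n] w y| ≤ ‖L ^ n‖ * d :=
  fun _ hv _ hw _ hd y => abs_iterate_sub_le (M := D.bellmanOp) (W := {v | IsBC v}) (fun _ hv => hD.isBC_bellmanOp hreg hv)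
    (fun _ hv _ hw _ hvw => hD.bellmanOp hreg (IsBC.isBM hv) (IsBC.isBM hw) hvw) n hv hw hd y

theorem exists_policyValue (hD : D.IsDominated L) (hreg : D.IsRegular)
    (hL : Summable fun n : ℕ => ‖L ^ n‖) {σ : X × Z → A} (hσ : D.IsPolicy σ) :
    ∃ w, IsBM w ∧ D.policyOp σ w = w ∧ D.IsPolicyValue σ w := by
  obtain ⟨w, hw, hfix, hlim⟩ := exists_fixedPoint_of_summable (W := {v | IsBM v})
    (fun _ hv => hD.isBM_policyOp hreg hσ hv) ⟨fun _ => 0, measurable_const, 0, by simp⟩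
    (fun _ hv => hv.2) (fun _ _ hF h => IsBM.of_tendstoUniformly hF h) hL
    (hD.abs_policyOp_iterate_sub_le hreg hσ)
  exact ⟨w, hw, hfix, fun v hv s => (hlim v (hreg.V_eq ▸ hv :)).tendsto_at s⟩

theorem exists_bellman_fixedPoint [CompactSpace A] (hD : D.IsDominated L) (hreg : D.IsRegular)
    (hL : Summable fun n : ℕ => ‖L ^ n‖) :
    ∃ w, IsBC w ∧ D.bellmanOp w = w ∧
      ∀ v, IsBC v → TendstoUniformly (fun n => D.bellmanOp^[n] v) w atTop :=
  exists_fixedPoint_of_summable (W := {v | IsBC v})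
    (fun _ hv => hD.isBC_bellmanOp hreg hv) ⟨fun _ => 0, continuous_const, 0, by simp⟩
    (fun _ hv => hv.2) (fun _ _ hF h => IsBC.of_tendstoUniformly hF h) hL
    (hD.abs_bellmanOp_iterate_sub_le hreg)

end IsDominated

theorem IsPolicyValue.unique {σ : X × Z → A} {v w : X × Z → ℝ} (hv : D.IsPolicyValue σ v)
    (hw : D.IsPolicyValue σ w) : v = w := by
  obtain ⟨v₀, hv₀⟩ := D.V_nonempty
  exact funext fun s => tendsto_nhds_unique (hv v₀ hv₀ s) (hw v₀ hv₀ s)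

theorem IsPolicyValue.eq_of_policyOp_eq {σ : X × Z → A} {v w : X × Z → ℝ}
    (hw : D.IsPolicyValue σ w) (hv : v ∈ D.V) (hfix : D.policyOp σ v = v) : w = v := by
  refine funext fun s => tendsto_nhds_unique (hw v hv s) ?_
  simp only [Function.iterate_fixed hfix]
  exact tendsto_const_nhds

theorem IsValueFunction.unique {v w : X × Z → ℝ} (hv : D.IsValueFunction v)
    (hw : D.IsValueFunction w) : v = w :=
  funext fun s => (hv.2 s).unique (hw.2 s)

/-! ### Comparison by monotone iteration -/

section Mono

variable (hD : D.IsDominated L) (hreg : D.IsRegular) (hmono : D.IsMonotone)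
include hD hreg hmono

theorem policyOp_iterate_mono {σ : X × Z → A} (hσ : D.IsPolicy σ) {v w : X × Z → ℝ}
    (hv : IsBM v) (hw : IsBM w) (hvw : ∀ s, v s ≤ w s) (n : ℕ) (s : X × Z) :
    (D.policyOp σ)^[n] v s ≤ (D.policyOp σ)^[n] w s := by
  have hmaps : MapsTo (D.policyOp σ) {v | IsBM v} {v | IsBM v} :=
    fun _ hv => hD.isBM_policyOp hreg hσ hv
  induction n generalizing s with
  | zero => exact hvw s
  | succ n ih =>
    rw [Function.iterate_succ_apply', Function.iterate_succ_apply']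
    exact hmono _ (hreg.V_eq ▸ hmaps.iterate n hv) _ (hreg.V_eq ▸ hmaps.iterate n hw) ih s _
      (hσ.2 s)

/-- By monotonicity the iterates decrease from v to the policy value. -/
theorem policyOp_le_of_le {σ : X × Z → A} (hσ : D.IsPolicy σ) {v w : X × Z → ℝ} (hv : IsBM v)
    (hw : D.IsPolicyValue σ w) (h : ∀ s, D.policyOp σ v s ≤ v s) (s : X × Z) : w s ≤ v s := by
  refine le_of_tendsto' (hw v (hreg.V_eq ▸ hv) s) fun n => ?_
  have hanti : ∀ n s, (D.policyOp σ)^[n + 1] v s ≤ (D.policyOp σ)^[n] v s := fun n s =>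
    policyOp_iterate_mono hD hreg hmono hσ (hD.isBM_policyOp hreg hσ hv) hv h n s
  exact antitone_nat_of_succ_le (f := fun n => (D.policyOp σ)^[n] v s)
    (fun n => hanti n s) (Nat.zero_le n)

/-- Here the iterates increase; comparing the limit with the first iterate instead of v gives the
improvement bound used in policy iteration. -/
theorem policyOp_le_policyValue {σ : X × Z → A} (hσ : D.IsPolicy σ) {v w : X × Z → ℝ}
    (hv : IsBM v) (hw : D.IsPolicyValue σ w) (h : ∀ s, v s ≤ D.policyOp σ v s) (s : X × Z) :
    D.policyOp σ v s ≤ w s := by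
  have hmon : ∀ n s, (D.policyOp σ)^[n] v s ≤ (D.policyOp σ)^[n + 1] v s := fun n s =>
    policyOp_iterate_mono hD hreg hmono hσ hv (hD.isBM_policyOp hreg hσ hv) h n s
  refine ge_of_tendsto (hw v (hreg.V_eq ▸ hv) s) ((eventually_ge_atTop 1).mono fun n hn => ?_)
  exact monotone_nat_of_le_succ (f := fun n => (D.policyOp σ)^[n] v s) (fun n => hmon n s) hn

/-- A solution of Bellman's equation attained by a greedy policy is the value function. -/
theorem isValueFunction_of_fixedPoint (hL : Summable fun n : ℕ => ‖L ^ n‖) {v : X × Z → ℝ}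
    (hv : IsBM v) (hfix : D.bellmanOp v = v) {σ : X × Z → A} (hσ : D.IsPolicy σ)
    (hσv : D.policyOp σ v = v) : D.IsValueFunction v ∧ D.IsPolicyValue σ v := by
  obtain ⟨w, -, -, hw⟩ := hD.exists_policyValue hreg hL hσ
  have hval : D.IsPolicyValue σ v := hw.eq_of_policyOp_eq (hreg.V_eq ▸ hv) hσv ▸ hw
  refine ⟨⟨fun τ hτ => ?_, fun s => ⟨?_, fun r hr => hr ⟨σ, v, hσ, hval, rfl⟩⟩⟩, hval⟩
  · obtain ⟨w, -, -, hw⟩ := hD.exists_policyValue hreg hL hτ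
    exact ⟨w, hw⟩
  · rintro _ ⟨τ, w, hτ, hw, rfl⟩
    refine policyOp_le_of_le hD hreg hmono hτ hv hw (fun s => ?_) s
    exact (hD.le_bellmanOp hreg hv (hτ.2 s)).trans_eq (congrFun hfix s)

end Mono

/-! ### Optimality and policy iteration for compact sets of real actions -/

section RealActions

variable {K : Set ℝ} [CompactSpace K] {D : DynamicProgram X Z K} {L : BMSpace Z →L[ℝ] BMSpace Z}

theorem bellmanOp_eq_of_isMaxOn {A : Type*} [MetricSpace A] [SecondCountableTopology A]
    [MeasurableSpace A] [BorelSpace A] {D : DynamicProgram X Z A} {v : X × Z → ℝ}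
    {s : X × Z} {a : A} (ha : a ∈ D.Γ s) (hmax : IsMaxOn (fun a => D.H s a v) (D.Γ s) a) :
    D.bellmanOp v s = D.H s a v :=
  IsGreatest.csSup_eq ⟨⟨a, ha, rfl⟩, by rintro _ ⟨a', ha', rfl⟩; exact hmax ha'⟩

/-- The value function solves Bellman's equation in `bc S`, some policy attains it, and value
iteration converges to it uniformly. -/
theorem exists_valueFunction (hD : D.IsDominated L) (hreg : D.IsRegular) (hmono : D.IsMonotone)
    (hL : Summable fun n : ℕ => ‖L ^ n‖) :
    ∃ v, D.IsValueFunction v ∧ IsBC v ∧ D.bellmanOp v = v ∧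
      (∃ σ, D.IsPolicy σ ∧ D.IsPolicyValue σ v) ∧
      ∀ w, IsBC w → TendstoUniformly (fun n => D.bellmanOp^[n] w) v atTop := by
  obtain ⟨v, hv, hfix, hlim⟩ := hD.exists_bellman_fixedPoint hreg hL
  obtain ⟨σ, hσm, hσ⟩ := exists_measurable_isMaxOn
    (f := fun s a => D.H s a v) hreg.upperHemicontinuous
    hreg.lowerHemicontinuous hreg.nonempty hreg.isCompact (hreg.continuous_H v hv)
  have hpol : D.IsPolicy σ := ⟨hσm, fun s => (hσ s).1⟩
  have hσv : D.policyOp σ v = v := funext fun s =>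
    (bellmanOp_eq_of_isMaxOn (hσ s).1 (hσ s).2).symm.trans (congrFun hfix s)
  obtain ⟨h1, h2⟩ := isValueFunction_of_fixedPoint hD hreg hmono hL hv.isBM hfix hpol hσv
  exact ⟨v, h1, hv, hfix, ⟨σ, hpol, h2⟩, hlim⟩

theorem optimalityResults (hD : D.IsDominated L) (hreg : D.IsRegular) (hmono : D.IsMonotone)
    (hL : Summable fun n : ℕ => ‖L ^ n‖) : D.OptimalityResults := by
  obtain ⟨v, hval, hv, hfix, ⟨σ₀, hσ₀, hσ₀v⟩, hlim⟩ := exists_valueFunction hD hreg hmono hL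
  refine ⟨fun σ hσ => ?_, ?_, fun σ hσ => ?_, ⟨v, hval, hv, hfix, fun w hw hwfix => ?_⟩,
    ⟨σ₀, hσ₀, v, hval, hσ₀v⟩, fun w hw σ hσ => ?_⟩
  · exact eventuallyContractingOn_of_summable (fun _ hv => hD.isBM_policyOp hreg hσ hv)
      (fun _ hv => hv.2) hL (fun _ => ContinuousLinearMap.opNorm_nonneg _) (hD.abs_policyOp_iterate_sub_le hreg hσ)
  · exact eventuallyContractingOn_of_summable (fun _ hv => hD.isBC_bellmanOp hreg hv)
      (fun _ hv => hv.2) hL (fun _ => ContinuousLinearMap.opNorm_nonneg _) (hD.abs_bellmanOp_iterate_sub_le hreg)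
  · obtain ⟨w, hw, -, hσw⟩ := hD.exists_policyValue hreg hL hσ
    exact ⟨w, hw, hσw⟩
  · refine funext fun s => tendsto_nhds_unique ?_ ((hlim w hw).tendsto_at s)
    simp only [Function.iterate_fixed hwfix]
    exact tendsto_const_nhds
  · obtain rfl := hw.unique hval
    constructor
    · rintro ⟨-, w', hw', hσw'⟩ s
      obtain rfl := hw'.unique hval
      obtain ⟨w, -, hwfix, hσw⟩ := hD.exists_policyValue hreg hL hσ
      obtain rfl := hσw.unique hσw'
      refine ⟨hσ.2 s, fun a ha => ?_⟩
      -- An optimal σ has value v*, so T_σ v* = v* = T v*: the action σ s attains the supremum.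
      exact (hD.le_bellmanOp hreg hv.isBM ha).trans_eq
        ((congrFun hfix s).trans (congrFun hwfix s).symm)
    · intro h
      have hσv : D.policyOp σ w = w := funext fun s =>
        (bellmanOp_eq_of_isMaxOn (h s).1 (h s).2).symm.trans (congrFun hfix s)
      exact ⟨hσ, w, hval,
        (isValueFunction_of_fixedPoint hD hreg hmono hL hv.isBM hfix hσ hσv).2⟩

/-- Each v k lies below v* and above the k-th value iterate from a constant under v 0, because T (v
k) ≤ v (k + 1) and T is monotone. -/
theorem policyIterationConverges (hD : D.IsDominated L) (hreg : D.IsRegular)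
    (hmono : D.IsMonotone) (hL : Summable fun n : ℕ => ‖L ^ n‖) :
    D.PolicyIterationConverges := by
  intro σ v hσ hv hstep vstar hvstar
  obtain ⟨v', hval, -, -, -, hlim⟩ := exists_valueFunction hD hreg hmono hL
  obtain rfl := hvstar.unique hval
  have hbm : ∀ k, IsBM (v k) ∧ D.policyOp (σ k) (v k) = v k := by
    intro k
    obtain ⟨w, hw, hwfix, hσw⟩ := hD.exists_policyValue hreg hL (hσ k)
    obtain rfl := hσw.unique (hv k)
    exact ⟨hw, hwfix⟩
  have hle : ∀ k s, v k s ≤ vstar s := fun k s => (hvstar.2 s).1 ⟨σ k, v k, hσ k, hv k, rfl⟩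
  have himp : ∀ k s, D.bellmanOp (v k) s ≤ v (k + 1) s := by
    intro k s
    rw [← hstep k]
    refine policyOp_le_policyValue hD hreg hmono (hσ (k + 1)) (hbm k).1 (hv (k + 1))
      (fun s => ?_) s
    rw [hstep k]
    exact (congrFun (hbm k).2 s).symm.le.trans (hD.le_bellmanOp hreg (hbm k).1 ((hσ k).2 s))
  obtain ⟨C, hC⟩ := (hbm 0).1.2
  -- The value v 0 need not be continuous, whereas value iteration is known to converge only from
  -- bc; hence the constant start.
  set w : X × Z → ℝ := fun _ => -C with hw_def
  have hw : IsBC w := ⟨continuous_const, |C|, fun _ => by simp [hw_def]⟩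
  have hmaps : MapsTo D.bellmanOp {v | IsBC v} {v | IsBC v} :=
    fun _ hv => hD.isBC_bellmanOp hreg hv
  have hlow : ∀ k s, D.bellmanOp^[k] w s ≤ v k s := by
    intro k
    induction k with
    | zero => exact fun s => (abs_le.1 (hC s)).1
    | succ k ih =>
      intro s
      rw [Function.iterate_succ_apply']
      exact (hD.bellmanOp_mono hreg hmono (IsBC.isBM (hmaps.iterate k hw)) (hbm k).1 ih s).trans
        (himp k s)
  have hU := hlim w hw
  rw [Metric.tendstoUniformly_iff] at hU ⊢
  intro ε hε
  filter_upwards [hU ε hε] with k hk s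
  refine lt_of_le_of_lt ?_ (hk s)
  rw [Real.dist_eq, Real.dist_eq, abs_of_nonneg (sub_nonneg.2 (hle k s)),
    abs_of_nonneg (sub_nonneg.2 ((hlow k s).trans (hle k s)))]
  linarith [hlow k s]

end RealActions

end DynamicProgram

/-! ### Parametrized integrals against a kernel -/

section KernelIntegral

variable {A Z : Type*} [MeasurableSpace Z] {Q : Kernel Z Z} [IsMarkovKernel Q] {v : A × Z → ℝ}

theorem IsBM.integrable_section [MeasurableSpace A] (hv : IsBM v) (a : A)
    (z : Z) : Integrable (fun z' => v (a, z')) (Q z) := by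
  obtain ⟨C, hC⟩ := hv.2
  exact Integrable.of_bound (hv.1.comp measurable_prodMk_left).aestronglyMeasurable C
    (Eventually.of_forall fun z' => hC (a, z'))

theorem measurable_integral_kernel_section [MeasurableSpace A]
    (hv : IsBM v) : Measurable fun p : A × Z => ∫ z', v (p.1, z') ∂(Q p.2) := by
  have h : Measurable fun q : (A × Z) × Z => v (q.1.1, q.2) := hv.1.comp (by fun_prop)
  exact (h.stronglyMeasurable.integral_kernel_prod_right'
    (κ := Q.comap Prod.snd measurable_snd)).measurable

/-- A Feller kernel integrates bounded continuous functions with a compact parameter to jointly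
continuous functions. -/
theorem IsFeller.continuous_integral_section [MetricSpace A] [CompactSpace A] [MetricSpace Z]
    [BorelSpace Z] (hQ : IsFeller Q) (hv : IsBC v) :
    Continuous fun p : A × Z => ∫ z', v (p.1, z') ∂(Q p.2) := by
  obtain ⟨C, hC⟩ := hv.2
  have hcont : Continuous v := hv.1
  rw [continuous_iff_continuousAt]
  rintro ⟨a, z⟩
  have hsec : ∀ a, IsBC fun z' => v (a, z') := fun a => ⟨by fun_prop, C, fun z' => hC _⟩
  have hint : ∀ {f : Z → ℝ}, IsBC f → ∀ z, Integrable f (Q z) := fun {f} hf z => by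
    obtain ⟨B, hB⟩ := hf.2
    exact Integrable.of_bound hf.1.measurable.aestronglyMeasurable B (Eventually.of_forall hB)
  set g : Z → A → ℝ := fun z' a' => |v (a', z') - v (a, z')| with hg
  have hgC : ∀ z' a', g z' a' ≤ C + C := fun z' a' =>
    (abs_sub _ _).trans (add_le_add (hC _) (hC _))
  -- The oscillation of v in the parameter near a. It is continuous in z' because closed balls of A
  -- are compact, so the Feller property applies to it.
  set osc : ℕ → Z → ℝ := fun n z' => sSup (g z' '' Metric.closedBall a (1 / ((n : ℝ) + 1)))
    with hosc
  have hbdd : ∀ (n : ℕ) z', BddAbove (g z' '' Metric.closedBall a (1 / ((n : ℝ) + 1))) :=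
    fun n z' => ⟨C + C, by rintro _ ⟨a', -, rfl⟩; exact hgC z' a'⟩
  have hne : ∀ (n : ℕ) z', (g z' '' Metric.closedBall a (1 / ((n : ℝ) + 1))).Nonempty :=
    fun n z' => ⟨_, a, Metric.mem_closedBall_self (by positivity), rfl⟩
  have hle : ∀ (n : ℕ) z' a', a' ∈ Metric.closedBall a (1 / ((n : ℝ) + 1)) → g z' a' ≤ osc n z' :=
    fun n z' a' ha' => le_csSup (hbdd n z') ⟨a', ha', rfl⟩
  have hosc0 : ∀ n z', 0 ≤ osc n z' := fun n z' =>
    (abs_nonneg _).trans (hle n z' a (Metric.mem_closedBall_self (by positivity)))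
  have hoscC : ∀ n z', osc n z' ≤ C + C := fun n z' =>
    csSup_le (hne n z') (by rintro _ ⟨a', -, rfl⟩; exact hgC z' a')
  have hoscBC : ∀ n, IsBC (osc n) := fun n =>
    ⟨(Metric.isClosed_closedBall.isCompact).continuous_sSup (by
      change Continuous fun q : Z × A => |v (q.2, q.1) - v (a, q.1)|
      fun_prop), C + C, fun z' => by
        rw [abs_of_nonneg (hosc0 n z')]; exact hoscC n z'⟩
  have hosc_lim : ∀ z', Tendsto (fun n => osc n z') atTop (𝓝 0) := by
    intro z'
    rw [Metric.tendsto_atTop]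
    intro ε hε
    have hca : ContinuousAt (fun a' => v (a', z')) a := by fun_prop
    obtain ⟨δ, hδ, hδε⟩ := Metric.continuousAt_iff.1 hca (ε / 2) (half_pos hε)
    obtain ⟨N, hN⟩ := exists_nat_one_div_lt hδ
    refine ⟨N, fun n hn => ?_⟩
    rw [Real.dist_eq, sub_zero, abs_of_nonneg (hosc0 n z')]
    refine lt_of_le_of_lt (csSup_le (hne n z') ?_) (half_lt_self hε)
    rintro _ ⟨a', ha', rfl⟩
    refine (hδε (lt_of_le_of_lt (Metric.mem_closedBall.1 ha') (lt_of_le_of_lt ?_ hN))).le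
    gcongr
  have hint_lim : Tendsto (fun n => ∫ z', osc n z' ∂(Q z)) atTop (𝓝 0) := by
    have := tendsto_integral_of_dominated_convergence (μ := Q z) (F := osc) (f := fun _ => 0)
      (fun _ => C + C) (fun n => (hoscBC n).1.measurable.aestronglyMeasurable)
      (integrable_const _) (fun n => Eventually.of_forall fun z' => by
        rw [Real.norm_eq_abs, abs_of_nonneg (hosc0 n z')]; exact hoscC n z')
      (Eventually.of_forall hosc_lim)
    simpa using this
  rw [Metric.continuousAt_iff']
  intro ε hε
  obtain ⟨n, hn⟩ := (hint_lim.eventually (gt_mem_nhds (half_pos hε))).exists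
  -- With n fixed so that the integral of `osc n` is small at z, Feller continuity keeps it small at
  -- nearby points; no uniformity over the measures Q(z, ·) is required.
  have h1 := (((hQ _ (hoscBC n)).1.comp (continuous_snd (X := A))).tendsto (a, z)).eventually
    (gt_mem_nhds hn)
  have h2 := Metric.continuousAt_iff'.1
    (((hQ _ (hsec a)).1.comp (continuous_snd (X := A))).continuousAt (x := (a, z)))
    (ε / 2) (half_pos hε)
  have h3 := (continuous_fst.tendsto (a, z)).eventually
    (Metric.closedBall_mem_nhds a (Nat.one_div_pos_of_nat (α := ℝ) (n := n)))
  filter_upwards [h1, h2, h3] with p hp1 hp2 hp3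
  rw [Real.dist_eq] at hp2 ⊢
  have h4 : |∫ z', v (p.1, z') ∂(Q p.2) - ∫ z', v (a, z') ∂(Q p.2)|
      ≤ ∫ z', osc n z' ∂(Q p.2) := by
    rw [← integral_sub (hint (hsec _) _) (hint (hsec _) _)]
    refine abs_integral_le_integral_abs.trans ?_
    exact integral_mono ((hint (hsec _) _).sub (hint (hsec _) _)).abs (hint (hoscBC n) _)
      fun z' => hle n z' p.1 hp3
  simp only [Function.comp] at hp1 hp2
  have h5 := abs_sub_le (∫ z', v (p.1, z') ∂(Q p.2)) (∫ z', v (a, z') ∂(Q p.2))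
    (∫ z', v (a, z') ∂(Q z))
  linarith

end KernelIntegral

/-! ### The household problem -/

section Household

variable {Z : Type*} [MetricSpace Z] [MeasurableSpace Z] [BorelSpace Z]
  {Q : Kernel Z Z} {X : Set ℝ} {R P T β : Z → ℝ} {u : ℝ → ℝ}

/-- Needed because u is continuous only on [0, ∞). -/
theorem consumption_nonneg {x a r p t : ℝ} (hr : 0 < r) (hp : 0 < p)
    (ha : a ≤ x * r + t * r * p) : 0 ≤ x / p + t - a / (r * p) := by
  have h : x / p + t - a / (r * p) = (x * r + t * r * p - a) / (r * p) := by
    field_simp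
  rw [h]
  exact div_nonneg (by linarith) (by positivity)

theorem householdProblem_upperHemicontinuous [CompactSpace X] (hR : Continuous R)
    (hP : Continuous P) (hT : Continuous T) :
    UpperHemicontinuous (householdProblem X R P T β u Q).Γ := by
  refine upperHemicontinuous_iff.2 fun s => UpperHemicontinuousAt.of_sequences
    (K := univ) isCompact_univ.isSeqCompact (Eventually.of_forall fun _ => subset_univ _) ?_
  intro x hx y hy a ha
  have hb : Continuous fun s : X × Z => (s.1 : ℝ) * R s.2 + T s.2 * R s.2 * P s.2 := by fun_prop
  have ha' : Tendsto (fun n => (y n : ℝ)) atTop (𝓝 (a : ℝ)) :=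
    (continuous_subtype_val.tendsto a).comp ha
  exact ⟨ge_of_tendsto' ha' fun n => (hy n).1,
    le_of_tendsto_of_tendsto' ha' ((hb.tendsto s).comp hx) fun n => (hy n).2⟩

theorem householdProblem_zero_mem (hX_nonneg : X ⊆ Ici 0) (hX_zero : (0 : ℝ) ∈ X)
    (hR : ∀ z, 0 < R z) (hP : ∀ z, 0 < P z) (hT : ∀ z, 0 ≤ T z) (s : X × Z) :
    (⟨0, hX_zero⟩ : X) ∈ (householdProblem X R P T β u Q).Γ s := by
  have h1 : 0 ≤ (s.1 : ℝ) := hX_nonneg s.1.2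
  have h2 := (hR s.2).le
  have h3 := (hP s.2).le
  have h4 := hT s.2
  exact ⟨le_rfl, by positivity⟩

/-- A feasible a is approximated by its truncation at the moving upper bound m. The truncation lies
between 0 and a, both in Γ s, so the interval hypothesis keeps it in X. -/
theorem householdProblem_lowerHemicontinuous (hX_nonneg : X ⊆ Ici 0) (hX_zero : (0 : ℝ) ∈ X)
    (hR_pos : ∀ z, 0 < R z) (hP_pos : ∀ z, 0 < P z) (hT_nonneg : ∀ z, 0 ≤ T z)
    (hΓ : ∀ x ∈ X, ∀ z, (X ∩ Icc 0 (x * R z + T z * R z * P z)).OrdConnected)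
    (hR : Continuous R) (hP : Continuous P) (hT : Continuous T) :
    LowerHemicontinuous (householdProblem X R P T β u Q).Γ := by
  have hzero := fun s => householdProblem_zero_mem (β := β) (u := u) (Q := Q) hX_nonneg hX_zero
    hR_pos hP_pos hT_nonneg s
  refine lowerHemicontinuous_iff.2 fun s => LowerHemicontinuousAt.of_sequences ?_
  intro x hx a ha
  set m : X × Z → ℝ := fun s => (s.1 : ℝ) * R s.2 + T s.2 * R s.2 * P s.2 with hm
  have hb : Continuous m := by fun_prop
  have hmem : ∀ s', min (a : ℝ) (m s') ∈ X ∩ Icc 0 (m s) := fun s' =>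
    (hΓ s.1 s.1.2 s.2).out ⟨hX_zero, (hzero s)⟩ ⟨a.2, ha⟩
      ⟨le_min ha.1 (hzero s').2, min_le_left _ _⟩
  refine ⟨fun n => ⟨min (a : ℝ) (m (x n)), (hmem (x n)).1⟩,
    fun n => ⟨(hmem (x n)).2.1, min_le_right _ _⟩, tendsto_subtype_rng.2 ?_⟩
  have h := (tendsto_const_nhds (x := (a : ℝ))).min ((hb.tendsto s).comp hx)
  rwa [min_eq_left ha.2] at h

theorem householdProblem_isRegular [IsMarkovKernel Q] (hX : IsCompact X)
    (hX_nonneg : X ⊆ Ici 0) (hX_zero : (0 : ℝ) ∈ X)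
    (hR_pos : ∀ z, 0 < R z) (hP_pos : ∃ ε > 0, ∀ z, ε ≤ P z) (hT_nonneg : ∀ z, 0 ≤ T z)
    (hΓ : ∀ x ∈ X, ∀ z, (X ∩ Icc 0 (x * R z + T z * R z * P z)).OrdConnected)
    (hR : Continuous R) (hP : Continuous P) (hT : IsBC T) (hβ : Continuous β)
    (hu : ContinuousOn u (Ici 0)) (hQ : IsFeller Q) :
    (householdProblem X R P T β u Q).IsRegular := by
  have : CompactSpace X := isCompact_iff_compactSpace.1 hX
  obtain ⟨ε, hε, hPε⟩ := hP_pos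
  have hP_pos : ∀ z, 0 < P z := fun z => hε.trans_le (hPε z)
  have hTc : Continuous T := hT.1
  have hzero := fun s => householdProblem_zero_mem (β := β) (u := u) (Q := Q) hX_nonneg hX_zero
    hR_pos hP_pos hT_nonneg s
  set D := householdProblem X R P T β u Q with hD
  have hF : Continuous fun p : (X × Z) × X =>
      (p.1.1 : ℝ) / P p.1.2 + T p.1.2 - (p.2 : ℝ) / (R p.1.2 * P p.1.2) := by
    have h1 : ∀ p : (X × Z) × X, P p.1.2 ≠ 0 := fun p => (hP_pos _).ne'
    have h2 : ∀ p : (X × Z) × X, R p.1.2 * P p.1.2 ≠ 0 :=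
      fun p => (mul_pos (hR_pos _) (hP_pos _)).ne'
    exact (Continuous.add (Continuous.div (by fun_prop) (by fun_prop) h1) (by fun_prop)).sub
      (Continuous.div (by fun_prop) (by fun_prop) h2)
  have hF0 : ∀ p : {p : (X × Z) × X // p.2 ∈ D.Γ p.1}, (0 : ℝ) ≤
      (p.1.1.1 : ℝ) / P p.1.1.2 + T p.1.1.2 - (p.1.2 : ℝ) / (R p.1.1.2 * P p.1.1.2) :=
    fun p => consumption_nonneg (hR_pos _) (hP_pos _) p.2.2
  have huF : Continuous fun p : {p : (X × Z) × X // p.2 ∈ D.Γ p.1} =>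
      u ((p.1.1.1 : ℝ) / P p.1.1.2 + T p.1.1.2 - (p.1.2 : ℝ) / (R p.1.1.2 * P p.1.1.2)) :=
    hu.comp_continuous (hF.comp continuous_subtype_val) hF0
  have hpair : Continuous fun p : {p : (X × Z) × X // p.2 ∈ D.Γ p.1} => (p.1.2, p.1.1.2) := by
    fun_prop
  have hβc : Continuous fun p : {p : (X × Z) × X // p.2 ∈ D.Γ p.1} => β p.1.1.2 := by fun_prop
  refine
    { V_eq := rfl
      upperHemicontinuous := householdProblem_upperHemicontinuous hR hP hTc
      lowerHemicontinuous := householdProblem_lowerHemicontinuous hX_nonneg hX_zero hR_pos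
        hP_pos hT_nonneg hΓ hR hP hTc
      nonempty := fun s => ⟨_, hzero s⟩
      isCompact := fun s => (isClosed_Icc.preimage continuous_subtype_val).isCompact
      measurable_H := fun v hv => huF.measurable.add (hβc.measurable.mul
        ((measurable_integral_kernel_section hv).comp hpair.measurable))
      continuous_H := fun v hv => huF.add (hβc.mul
        ((hQ.continuous_integral_section hv).comp hpair))
      bounded_H := ?_ }
  obtain ⟨M, hM⟩ := hX.isBounded.bddAbove
  obtain ⟨CT, hCT⟩ := hT.2
  -- With continuation value 0 only utility remains, and feasible consumption stays in this compact
  -- interval: assets are at most M, prices at least ε, transfers at most CT.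
  obtain ⟨C, hC⟩ := (isCompact_Icc (a := (0 : ℝ)) (b := M / ε + CT)).exists_bound_of_continuousOn
    (hu.mono Icc_subset_Ici_self)
  refine ⟨fun _ => 0, ⟨continuous_const, 0, by simp⟩, C, fun s a ha => ?_⟩
  have hH : D.H s a (fun _ => 0)
      = u ((s.1 : ℝ) / P s.2 + T s.2 - (a : ℝ) / (R s.2 * P s.2)) := by
    simp [hD, householdProblem]
  rw [hH]
  refine hC _ ⟨hF0 ⟨(s, a), ha⟩, ?_⟩
  have h1 : (s.1 : ℝ) / P s.2 ≤ M / ε :=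
    div_le_div₀ ((hX_nonneg s.1.2).trans (hM s.1.2)) (hM s.1.2) hε (hPε _)
  have h2 : 0 ≤ (a : ℝ) / (R s.2 * P s.2) :=
    div_nonneg ha.1 (mul_pos (hR_pos _) (hP_pos _)).le
  linarith [(le_abs_self _).trans (hCT s.2)]

theorem householdProblem_isMonotone [IsMarkovKernel Q] (hβ : ∀ z, 0 ≤ β z) :
    (householdProblem X R P T β u Q).IsMonotone := by
  intro v hv w hw hvw s a _
  exact add_le_add_right (mul_le_mul_of_nonneg_left
    (integral_mono (IsBM.integrable_section hv a s.2) (IsBM.integrable_section hw a s.2)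
      fun z' => hvw (a, z')) (hβ s.2)) _

theorem householdProblem_abs_sub_le [IsMarkovKernel Q] (hβ : ∀ z, 0 ≤ β z)
    {v w : X × Z → ℝ} (hv : IsBM v) (hw : IsBM w) (x : X) (z : Z) (a : X) :
    ENNReal.ofReal |(householdProblem X R P T β u Q).H (x, z) a v
        - (householdProblem X R P T β u Q).H (x, z) a w|
      ≤ ENNReal.ofReal (β z)
        * ∫⁻ z', (⨆ x', ENNReal.ofReal |v (x', z') - w (x', z')|) ∂(Q z) := by
  have h : (householdProblem X R P T β u Q).H (x, z) a v
      - (householdProblem X R P T β u Q).H (x, z) a w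
      = β z * ∫ z', (v (a, z') - w (a, z')) ∂(Q z) := by
    rw [integral_sub (hv.integrable_section a z) (hw.integrable_section a z)]
    simp only [householdProblem]
    ring
  rw [h, abs_mul, abs_of_nonneg (hβ z), ENNReal.ofReal_mul (hβ z), ← Real.enorm_eq_ofReal_abs]
  gcongr
  refine (enorm_integral_le_lintegral_enorm _).trans (lintegral_mono fun z' => ?_)
  rw [Real.enorm_eq_ofReal_abs]
  exact le_iSup (fun x' : X => ENNReal.ofReal |v (x', z') - w (x', z')|) a

end Household

theorem propositionp {Z : Type*} [MetricSpace Z] [MeasurableSpace Z] [BorelSpace Z]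
    (Q : Kernel Z Z) [IsMarkovKernel Q]
    (X : Set ℝ) (hX : IsCompact X) (hX_nonneg : X ⊆ Ici 0) (hX_zero : (0 : ℝ) ∈ X)
    (R P T β : Z → ℝ) (u : ℝ → ℝ)
    -- standing assumptions of the model
    (hR_pos : ∃ ε > 0, ∀ z, ε ≤ R z) (hP_pos : ∃ ε > 0, ∀ z, ε ≤ P z)
    (hT_nonneg : ∀ z, 0 ≤ T z) (hβ_nonneg : ∀ z, 0 ≤ β z)
    -- the feasible sets are intervals
    (hΓ : ∀ x ∈ X, ∀ z, (X ∩ Icc 0 (x * R z + T z * R z * P z)).OrdConnected)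
    -- (i), (ii), (iii), (iv)
    (hR : IsBC R) (hP : IsBC P) (hT : IsBC T) (hβ : IsBC β)
    (hu : ContinuousOn u (Ici 0))
    (hr : ∃ r < 1, HasSpectralRadius (discountOp Q β hβ.isBM) r)
    (hQ : IsFeller Q) :
    (householdProblem X R P T β u Q).IsRegular ∧
      (householdProblem X R P T β u Q).IsMonotone ∧
      (householdProblem X R P T β u Q).IsLongRunContractive Q ∧
      (householdProblem X R P T β u Q).OptimalityResults ∧
      (householdProblem X R P T β u Q).PolicyIterationConverges := by
  have : CompactSpace X := isCompact_iff_compactSpace.1 hX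
  have hR_pos' : ∀ z, 0 < R z := fun z => by
    obtain ⟨ε, hε, h⟩ := hR_pos
    exact hε.trans_le (h z)
  have hreg : (householdProblem X R P T β u Q).IsRegular :=
    householdProblem_isRegular hX hX_nonneg hX_zero hR_pos' hP_pos hT_nonneg hΓ hR.1 hP.1 hT hβ.1
      hu hQ
  have hmono : (householdProblem X R P T β u Q).IsMonotone :=
    householdProblem_isMonotone hβ_nonneg
  have hlip := fun v (hv : v ∈ (householdProblem X R P T β u Q).V)
      w (hw : w ∈ (householdProblem X R P T β u Q).V) x z a
      (_ : a ∈ (householdProblem X R P T β u Q).Γ (x, z)) =>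
    householdProblem_abs_sub_le (Q := Q) (R := R) (P := P) (T := T) (u := u) hβ_nonneg hv hw x z a
  have hdom := DynamicProgram.isDominated_of_lintegral hβ.isBM hβ_nonneg hreg.V_eq hlip
  have hL : Summable fun n : ℕ => ‖discountOp Q β hβ.isBM ^ n‖ := by
    obtain ⟨r, hr1, hr⟩ := hr
    exact hr.summable_norm_pow hr1
  exact ⟨hreg, hmono, ⟨β, hβ.isBM, hβ_nonneg, hlip, hr⟩,
    DynamicProgram.optimalityResults hdom hreg hmono hL,
    DynamicProgram.policyIterationConverges hdom hreg hmono hL⟩
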